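/- Let $k$ be an algebraically closed field and $A$ an associative $k$-algebra. Let $L(\lambda)$, $\lambda\in\pi$, be a full set of pairwise non-isomorphic simple left $A$-modules, indexed by a partially ordered set $\pi$, and let $P(\lambda)$ be a projective cover of $L(\lambda)$. Suppose that at least one of the following holds. (a) $A$ is a cellular algebra: there are a finite poset $\Lambda$, finite sets $M(\ell)$ for $\ell\in\Lambda$, a $k$-basis $C^{\ell}_{S,T}$ ($\ell\in\Lambda$, $S,T\in M(\ell)$) of $A$ and a $k$-linear anti-automorphism $i$ of $A$ with $i^2=\mathrm{id}$ and $i(C^{\ell}_{S,T})=C^{\ell}_{T,S}$, such that for all $a\in A$, $\ell\in\Lambda$ and $S,T\in M(\ell)$ one has $aC^{\ell}_{S,T}\equiv\sum_{U\in M(\ell)}r^{\ell}_a(U,S)\,C^{\ell}_{U,T}$ modulo the span of the basis elements with upper index strictly less than $\ell$, where the $r^{\ell}_a(U,S)\in k$ do not depend on $T$. (b) $A$ is a BGG algebra with respect to the poset $\pi$. That is, $A$ is finite dimensional and, with $\Delta(\lambda)$ the largest quotient of $P(\lambda)$ all of whose composition factors are of the form $L(\mu)$ with $\mu\le\lambda$: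 one has $\operatorname{End}_A(\Delta(\lambda))\cong k$ for all $\lambda\in\pi$; every finitely generated projective $A$-module has a finite filtration whose subquotients are standard modules $\Delta(\lambda)$; and there is a contravariant, exact, additive, $k$-linear functor $\delta$ from the category of finitely generated $A$-modules to itself with $\delta\circ\delta$ naturally isomorphic to the identity and $\delta(L(\lambda))\cong L(\lambda)$ for all $\lambda\in\pi$. Put $\operatorname{rad}^0M=M$ and $\operatorname{rad}^{s}M=\operatorname{rad}(\operatorname{rad}^{s-1}M)$, and let $\operatorname{rad}_sM=\operatorname{rad}^{s-1}M/\operatorname{rad}^sM$ be the $s$-th radical layer of $M$, for $s\ge1$. Then for all $\lambda,\mu\in\pi$ and all $s\ge1$ the composition multiplicities satisfy $$[\operatorname{rad}_sP(\mu):L(\lambda)]=[\operatorname{rad}_sP(\lambda):L(\mu)].$$ -/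

import Mathlib

open CategoryTheory

universe u v w w'

namespace LoewyReciprocity

section Modules

variable (A : Type u) [Ring A]

/-- The `i`-th factor `s (i+1) / s i` of a composition series of submodules. -/
abbrev factor {M : Type*} [AddCommGroup M] [Module A M]
    (s : CompositionSeries (Submodule A M)) (i : Fin s.length) : Type _ :=
  s i.succ ⧸ (s i.castSucc).comap (s i.succ).subtype

/-- The number of factors of a composition series which are isomorphic to `S`. -/
noncomputable def countFactors {M : Type*} [AddCommGroup M] [Module A M]
    (s : CompositionSeries (Submodule A M)) (S : Type*) [AddCommGroup S] [Module A S] : ℕ :=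
  Nat.card {i : Fin s.length // Nonempty (factor A s i ≃ₗ[A] S)}

open Classical in
/-- The composition multiplicity `[M : S]`: the number of factors isomorphic to `S` in a
composition series of `M`. All modules to which this is applied below have finite length;
see `compMult_eq` for independence of the series. -/
noncomputable def compMult (M : Type*) [AddCommGroup M] [Module A M]
    (S : Type*) [AddCommGroup S] [Module A S] : ℕ :=
  if h : ∃ s : CompositionSeries (Submodule A M), s.head = ⊥ ∧ s.last = ⊤ then
    countFactors A h.choose S
  else 0

/-- The multiplicity may be computed from any composition series (Jordan-Hölder). -/
theorem compMult_eq {M : Type*} [AddCommGroup M] [Module A M]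
    (S : Type*) [AddCommGroup S] [Module A S]
    (s : CompositionSeries (Submodule A M)) (h₀ : s.head = ⊥) (h₁ : s.last = ⊤) :
    compMult A M S = countFactors A s S := by
  have h : ∃ s : CompositionSeries (Submodule A M), s.head = ⊥ ∧ s.last = ⊤ := ⟨s, h₀, h₁⟩
  rw [compMult, dif_pos h]
  obtain ⟨f, hf⟩ := CompositionSeries.jordan_holder h.choose s
    (h.choose_spec.1.trans h₀.symm) (h.choose_spec.2.trans h₁.symm)
  refine Nat.card_congr (f.subtypeEquiv fun i => ?_)
  have e := (hf i).linearEquiv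
  exact ⟨fun ⟨g⟩ => ⟨e.symm.trans g⟩, fun ⟨g⟩ => ⟨e.trans g⟩⟩

/-- For an Artinian module, the radical `Module.jacobson A M` (the intersection of the maximal
submodules) is the smallest submodule with semisimple quotient. -/
theorem isLeast_jacobson (M : Type*) [AddCommGroup M] [Module A M] [IsArtinian A M] :
    IsLeast {N : Submodule A M | IsSemisimpleModule A (M ⧸ N)} (Module.jacobson A M) := by
  refine ⟨?_, fun N (hN : IsSemisimpleModule A (M ⧸ N)) => ?_⟩
  · exact (IsArtinian.isSemisimpleModule_iff_jacobson A _).2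
      (Module.jacobson_quotient_jacobson A M)
  · exact Module.jacobson_le_of_eq_bot (IsSemisimpleModule.jacobson_eq_bot A _)

/-- The radical series: `rad⁰ M = M` and `radˢ⁺¹ M = rad (radˢ M)`. -/
def radPow (M : Type*) [AddCommGroup M] [Module A M] : ℕ → Submodule A M
  | 0 => ⊤
  | s + 1 => (Module.jacobson A (radPow M s)).map (radPow M s).subtype

/-- The `s`-th radical layer `radˢ⁻¹ M / radˢ M`, for `s ≥ 1`; the first one is the head. -/
abbrev radLayer (M : Type*) [AddCommGroup M] [Module A M] (s : ℕ) : Type _ :=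
  radPow A M (s - 1) ⧸ (radPow A M s).comap (radPow A M (s - 1)).subtype

/-- `p : P → L` is a projective cover: `P` is projective and `p` is surjective with
superfluous kernel. -/
structure IsProjectiveCover {P L : Type u} [AddCommGroup P] [Module A P]
    [AddCommGroup L] [Module A L] (p : P →ₗ[A] L) : Prop where
  projective : Module.Projective A P
  surjective : Function.Surjective p
  superfluous : ∀ N : Submodule A P, N ⊔ LinearMap.ker p = ⊤ → N = ⊤

/-- `L` is a full set of simple `A`-modules: every `L a` is simple, they are pairwise
non-isomorphic, and every simple `A`-module is isomorphic to one of them. -/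
structure IsFullSetOfSimples {π : Type w} (L : π → Type u)
    [∀ a, AddCommGroup (L a)] [∀ a, Module A (L a)] : Prop where
  simple : ∀ a, IsSimpleModule A (L a)
  injective : ∀ a b, Nonempty (L a ≃ₗ[A] L b) → a = b
  complete : ∀ (S : Type u) [AddCommGroup S] [Module A S],
    IsSimpleModule A S → ∃ a, Nonempty (S ≃ₗ[A] L a)

end Modules

section Cellular

variable (k : Type v) [Field k] (A : Type u) [Ring A] [Algebra k A]

/-- A cell datum `(Λ, M, C, i)` for the `k`-algebra `A` (Graham-Lehrer). -/
structure CellDatum where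
  /-- The finite poset of cell indices. -/
  Λ : Type w'
  [partialOrder : PartialOrder Λ]
  [finite_Λ : Finite Λ]
  /-- The finite sets indexing rows and columns of the cells. -/
  M : Λ → Type w'
  [fintype_M : ∀ l, Fintype (M l)]
  /-- The cellular basis; `C ⟨l, S, T⟩` is the element with upper index `l`. -/
  C : Module.Basis (Σ l, M l × M l) k A
  /-- The anti-involution. -/
  i : A →ₗ[k] A
  i_mul : ∀ a b, i (a * b) = i b * i a
  i_i : ∀ a, i (i a) = a
  i_C : ∀ l (S T : M l), i (C ⟨l, S, T⟩) = C ⟨l, T, S⟩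
  /-- The coefficients `r l a U S`, which do not depend on `T`. -/
  r : ∀ l, A → M l → M l → k
  mul_C : ∀ l (a : A) (S T : M l),
    a * C ⟨l, S, T⟩ - ∑ U, r l a U S • C ⟨l, U, T⟩ ∈
      Submodule.span k {x | ∃ l' < l, ∃ X Y : M l', x = C ⟨l', X, Y⟩}

/-- `A` is a cellular algebra. -/
def IsCellular : Prop := Nonempty (CellDatum.{u, v, w'} k A)

end Cellular

section BGG

variable (k : Type v) [Field k] (A : Type u) [Ring A] [Algebra k A]

section

variable {π : Type w} [PartialOrder π] (L P : π → Type u)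
  [∀ a, AddCommGroup (L a)] [∀ a, Module A (L a)]
  [∀ a, AddCommGroup (P a)] [∀ a, Module A (P a)]

/-- The submodule `N` of `P a` for which `P a ⧸ N` is the maximal factor module of `P a` all of
whose composition factors are of the form `L b` with `b ≤ a`: the smallest submodule with that
property. -/
def standardKernel (a : π) : Submodule A (P a) :=
  sInf {N | ∀ b, compMult A (P a ⧸ N) (L b) ≠ 0 → b ≤ a}

/-- The standard module `Δ a`. -/
abbrev Standard (a : π) : Type u := P a ⧸ standardKernel A L P a

/-- `Q` has a finite filtration all of whose subquotients are standard modules. -/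
def HasStandardFiltration (Q : Type u) [AddCommGroup Q] [Module A Q] : Prop :=
  ∃ (n : ℕ) (F : ℕ → Submodule A Q), Monotone F ∧ F 0 = ⊥ ∧ F n = ⊤ ∧
    ∀ m < n, ∃ a, Nonempty ((F (m + 1) ⧸ (F m).comap (F (m + 1)).subtype)
      ≃ₗ[A] Standard A L P a)

/-- `A` is quasi-hereditary, with respect to the poset `π`, the simple modules `L a` and their
projective covers `P a`. -/
structure IsQuasiHereditary : Prop where
  finiteDimensional : FiniteDimensional k A
  /-- `k ≅ End_A (Δ a)`, by letting scalars act. -/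
  end_standard : ∀ a (φ : Standard A L P a →ₗ[A] Standard A L P a),
    ∃! c : k, ∀ x, φ x = algebraMap k A c • x
  /-- Every (finitely generated) projective module has a filtration by standard modules. -/
  filtration : ∀ (Q : Type u) [AddCommGroup Q] [Module A Q],
    Module.Finite A Q → Module.Projective A Q → HasStandardFiltration A L P Q

end

/-- A duality on the category of finitely generated `A`-modules: a contravariant, exact,
additive, `k`-linear functor whose square is naturally isomorphic to the identity. -/
structure IsDuality (δ : (FGModuleCat.{u} A)ᵒᵖ ⥤ FGModuleCat.{u} A) : Prop where
  additive : δ.Additive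
  linear : ∀ {X Y : FGModuleCat.{u} A} (c : k) (f : X ⟶ Y), δ.map (c • f).op = c • δ.map f.op
  exact : ∀ {X Y Z : FGModuleCat.{u} A} (f : X ⟶ Y) (g : Y ⟶ Z),
    Function.Exact f.hom.hom g.hom.hom →
      Function.Exact (δ.map g.op).hom.hom (δ.map f.op).hom.hom
  square : Nonempty (δ.rightOp ⋙ δ ≅ 𝟭 (FGModuleCat.{u} A))

/-- `A` is a BGG algebra, with respect to the poset `π`, the simple modules `L a` and their
projective covers `P a`: it is quasi-hereditary and has a duality fixing all simple modules. -/
structure IsBGG {π : Type w} [PartialOrder π] (L P : π → Type u)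
    [∀ a, AddCommGroup (L a)] [∀ a, Module A (L a)]
    [∀ a, AddCommGroup (P a)] [∀ a, Module A (P a)] : Prop where
  quasiHereditary : IsQuasiHereditary k A L P
  duality : ∃ δ : (FGModuleCat.{u} A)ᵒᵖ ⥤ FGModuleCat.{u} A, IsDuality k A δ ∧
    ∀ (a : π) (X : FGModuleCat.{u} A), Nonempty (X ≃ₗ[A] L a) →
      Nonempty (δ.obj (Opposite.op X) ≃ₗ[A] L a)

end BGG

end LoewyReciprocity

/-! Each hypothesis makes `A` finite dimensional and yields a contravariant exact functor `D` on
finitely generated modules which fixes the simple modules up to isomorphism and satisfies `dim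
Hom(X, DY) = dim Hom(Y, DX)`; this is `SelfDuality`. The reciprocity follows from these properties
alone.

Let `P → L` and `P' → L'` be projective covers of simple modules and `J` the radical of `A`. Since
`k` is algebraically closed, `[X : L] = dim Hom(P, X)`, and also `[X : L] = dim Hom(P, DX)` because
`D` fixes simple modules. Moreover `D` sends modules killed by `Jˢ` to modules killed by `Jˢ`
(`SelfDuality.jacobsonIter_obj`). With `Q = P/radˢ P` and `Q' = P'/radˢ P'` this gives `[Q' : L] =
dim Hom(P, DQ') = dim Hom(Q, DQ') = dim Hom(Q', DQ) = dim Hom(P', DQ) = [Q : L']`, and subtracting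
the equalities for consecutive `s` gives the radical layers.

For a BGG algebra, `D` is the given duality. For a cellular algebra, it is the `k`-dual twisted by
the anti-involution. This fixes a simple module because the module is recovered from any apex of it,
as the cell module modulo the radical of its form, and the twisted dual has the same apex. -/

namespace LoewyReciprocity

/-! ### Radical powers as iterated multiplication by the Jacobson radical -/

section JacobsonIterates

variable (A : Type u) [Ring A] {M N : Type*} [AddCommGroup M] [Module A M]
  [AddCommGroup N] [Module A N]

/-- The submodule `Jˢ N`, for the Jacobson radical `J` of `A`. -/
def jacobsonIter (s : ℕ) (N : Submodule A M) : Submodule A M :=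
  (fun N' : Submodule A M => Ring.jacobson A • N')^[s] N

theorem jacobsonIter_succ (s : ℕ) (N : Submodule A M) :
    jacobsonIter A (s + 1) N = jacobsonIter A s (Ring.jacobson A • N) :=
  Function.iterate_succ_apply _ _ _

theorem jacobsonIter_succ' (s : ℕ) (N : Submodule A M) :
    jacobsonIter A (s + 1) N = Ring.jacobson A • jacobsonIter A s N :=
  Function.iterate_succ_apply' _ _ _

theorem jacobsonIter_mono (s : ℕ) {N₁ N₂ : Submodule A M} (h : N₁ ≤ N₂) :
    jacobsonIter A s N₁ ≤ jacobsonIter A s N₂ := by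
  induction s with
  | zero => exact h
  | succ s ih =>
    rw [jacobsonIter_succ', jacobsonIter_succ']
    exact smul_mono_right _ ih

theorem map_jacobsonIter (f : M →ₗ[A] N) (s : ℕ) (N₁ : Submodule A M) :
    (jacobsonIter A s N₁).map f = jacobsonIter A s (N₁.map f) := by
  induction s with
  | zero => rfl
  | succ s ih => rw [jacobsonIter_succ', jacobsonIter_succ', Submodule.map_smul'', ih]

/-- Such a module is a module over `A/J`, which is a semisimple ring. -/
theorem isSemisimpleModule_of_jacobson_smul_top [IsArtinianRing A]
    (h : Ring.jacobson A • (⊤ : Submodule A M) = ⊥) : IsSemisimpleModule A M := by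
  have hM : Module.IsTorsionBySet A M (Ring.jacobson A : Set A) := by
    rintro x ⟨a, ha⟩
    have := Submodule.smul_mem_smul ha (Submodule.mem_top : x ∈ (⊤ : Submodule A M))
    rwa [h, Submodule.mem_bot] at this
  let := hM.module
  exact hM.isSemisimpleModule_iff.1 inferInstance

theorem jacobson_smul_top_of_isSemisimpleModule [IsSemisimpleModule A M] :
    Ring.jacobson A • (⊤ : Submodule A M) = ⊥ :=
  le_bot_iff.1 ((Ring.jacobson_smul_top_le A M).trans
    (IsSemisimpleModule.jacobson_eq_bot A M).le)

theorem jacobson_eq_smul_top [IsArtinianRing A] :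
    Module.jacobson A M = Ring.jacobson A • (⊤ : Submodule A M) := by
  refine le_antisymm (Module.jacobson_le_of_eq_bot ?_) (Ring.jacobson_smul_top_le A M)
  have : IsSemisimpleModule A (M ⧸ Ring.jacobson A • (⊤ : Submodule A M)) := by
    apply isSemisimpleModule_of_jacobson_smul_top
    rw [← Submodule.range_mkQ, ← Submodule.map_top, ← Submodule.map_smul'', 
      ← le_bot_iff, Submodule.map_le_iff_le_comap, Submodule.comap_bot, Submodule.ker_mkQ]
  exact IsSemisimpleModule.jacobson_eq_bot _ _

/-- Over an Artinian ring `rad M = JM`. Unlike the radical, `Jˢ` commutes with images under every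
linear map. -/
theorem radPow_eq_jacobsonIter [IsArtinianRing A] (s : ℕ) :
    radPow A M s = jacobsonIter A s ⊤ := by
  induction s with
  | zero => rfl
  | succ s ih =>
    rw [radPow, jacobson_eq_smul_top, Submodule.map_smul'', Submodule.map_subtype_top, ih,
      jacobsonIter_succ']

end JacobsonIterates

/-! ### Dimensions of Hom spaces -/

section HomLength

variable (k : Type v) [Field k] (A : Type u) [Ring A] [Algebra k A]

/-- The dimension over `k` of the space of `A`-linear maps from `X` to `N`, where `k` acts through
`A`. -/
noncomputable def homLength (X N : Type*) [AddCommGroup X] [Module A X]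
    [AddCommGroup N] [Module A N] : ℕ∞ :=
  letI : Module k N := Module.restrictScalars k A N
  haveI : IsScalarTower k A N := IsScalarTower.restrictScalars k A N
  Module.length k (X →ₗ[A] N)

variable {A} {X Y N N₁ N₂ N₃ : Type*} [AddCommGroup X] [Module A X] [AddCommGroup Y] [Module A Y]
  [AddCommGroup N] [Module A N] [AddCommGroup N₁] [Module A N₁]
  [AddCommGroup N₂] [Module A N₂] [AddCommGroup N₃] [Module A N₃]

/-- Hypothesis `hk` is `k`-linearity of `e`, phrased through `algebraMap` because the modules carry
a `k`-structure only inside `homLength`. -/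
theorem homLength_le_of_injective (e : (X →ₗ[A] N₁) →+ (Y →ₗ[A] N₂))
    (he : Function.Injective e)
    (hk : ∀ (c : k) (f g : X →ₗ[A] N₁), (∀ x, g x = algebraMap k A c • f x) →
      ∀ y, e g y = algebraMap k A c • e f y) :
    homLength k A X N₁ ≤ homLength k A Y N₂ := by
  let _ : Module k N₁ := Module.restrictScalars k A N₁
  have : IsScalarTower k A N₁ := IsScalarTower.restrictScalars k A N₁
  let _ : Module k N₂ := Module.restrictScalars k A N₂
  have : IsScalarTower k A N₂ := IsScalarTower.restrictScalars k A N₂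
  exact Module.length_le_of_injective
    ({ e with map_smul' := fun c f => LinearMap.ext (hk c f (c • f) fun _ => rfl) } :
      (X →ₗ[A] N₁) →ₗ[k] (Y →ₗ[A] N₂)) he

theorem homLength_congr_right (e : N₁ ≃ₗ[A] N₂) : homLength k A X N₁ = homLength k A X N₂ := by
  refine le_antisymm (homLength_le_of_injective k
    ⟨⟨fun f => e.toLinearMap ∘ₗ f, LinearMap.comp_zero _⟩, fun f g => LinearMap.comp_add _ _ _⟩
    (fun f g h => LinearMap.ext fun x => e.injective (LinearMap.congr_fun h x))
    fun c f g h y => (congrArg e (h y)).trans (map_smul e _ _))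
    (homLength_le_of_injective k
    ⟨⟨fun f => e.symm.toLinearMap ∘ₗ f, LinearMap.comp_zero _⟩,
      fun f g => LinearMap.comp_add _ _ _⟩
    (fun f g h => LinearMap.ext fun x => e.symm.injective (LinearMap.congr_fun h x))
    fun c f g h y => (congrArg e.symm (h y)).trans (map_smul e.symm _ _))

theorem homLength_le_of_surjective (q : Y →ₗ[A] X) (hq : Function.Surjective q) :
    homLength k A X N ≤ homLength k A Y N :=
  homLength_le_of_injective k
    ⟨⟨fun f => f ∘ₗ q, LinearMap.zero_comp _⟩, fun _ _ => LinearMap.add_comp _ _ _⟩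
    (fun _ _ h => (LinearMap.cancel_right hq).1 h)
    fun _ _ _ h y => h (q y)

theorem homLength_eq_of_surjective (q : Y →ₗ[A] X) (hq : Function.Surjective q)
    (h : ∀ f : Y →ₗ[A] N, LinearMap.ker q ≤ LinearMap.ker f) :
    homLength k A X N = homLength k A Y N := by
  refine le_antisymm (homLength_le_of_surjective k q hq) ?_
  have hc : ∀ (f : Y →ₗ[A] N) (y : Y), 
      ((LinearMap.ker q).liftQ f (h f) ∘ₗ (q.quotKerEquivOfSurjective hq).symm.toLinearMap) (q y)
        = f y := fun f y => by
    have : (q.quotKerEquivOfSurjective hq).symm (q y) = (LinearMap.ker q).mkQ y := by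
      rw [LinearEquiv.symm_apply_eq]; rfl
    simp [this]
  refine homLength_le_of_injective k ⟨⟨fun f => (LinearMap.ker q).liftQ f (h f) ∘ₗ
      (q.quotKerEquivOfSurjective hq).symm.toLinearMap, ?_⟩, ?_⟩ ?_ ?_
  · ext x; obtain ⟨y, rfl⟩ := hq x; rw [hc]; rfl
  · intro f g; ext x; obtain ⟨y, rfl⟩ := hq x; rw [LinearMap.add_apply]; simp only [hc]; rfl
  · intro f g hfg; ext y; rw [← hc f y, ← hc g y]; exact LinearMap.congr_fun hfg _
  · intro c f g hfg x; obtain ⟨y, rfl⟩ := hq x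
    exact (hc g y).trans ((hfg y).trans (congrArg _ (hc f y).symm))

theorem homLength_eq_add_of_exact [Module.Projective A X] (f : N₁ →ₗ[A] N₂) (g : N₂ →ₗ[A] N₃)
    (hf : Function.Injective f) (hg : Function.Surjective g) (H : Function.Exact f g) :
    homLength k A X N₂ = homLength k A X N₁ + homLength k A X N₃ := by
  let _ : Module k N₁ := Module.restrictScalars k A N₁
  have : IsScalarTower k A N₁ := IsScalarTower.restrictScalars k A N₁
  let _ : Module k N₂ := Module.restrictScalars k A N₂
  have : IsScalarTower k A N₂ := IsScalarTower.restrictScalars k A N₂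
  let _ : Module k N₃ := Module.restrictScalars k A N₃
  have : IsScalarTower k A N₃ := IsScalarTower.restrictScalars k A N₃
  refine Module.length_eq_add_of_exact (R := k)
    ({ toFun := fun h => f ∘ₗ h
       map_add' := fun _ _ => LinearMap.comp_add _ _ _
       map_smul' := fun c h => LinearMap.ext fun x => map_smul f (algebraMap k A c) (h x) } :
      (X →ₗ[A] N₁) →ₗ[k] (X →ₗ[A] N₂))
    ({ toFun := fun h => g ∘ₗ h
       map_add' := fun _ _ => LinearMap.comp_add _ _ _
       map_smul' := fun c h => LinearMap.ext fun x => map_smul g (algebraMap k A c) (h x) } :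
      (X →ₗ[A] N₂) →ₗ[k] (X →ₗ[A] N₃)) ?_ ?_ ?_
  · intro a b h
    exact (LinearMap.cancel_left hf).1 h
  · intro h
    exact Module.projective_lifting_property g h hg
  · intro h
    constructor
    · intro h0
      have : ∀ x, h x ∈ LinearMap.range f := fun x => (H (h x)).1 (LinearMap.congr_fun h0 x)
      refine ⟨(LinearEquiv.ofInjective f hf).symm.toLinearMap ∘ₗ h.codRestrict _ this, ?_⟩
      ext x
      have := LinearEquiv.apply_symm_apply (LinearEquiv.ofInjective f hf) ⟨h x, this x⟩
      exact congrArg Subtype.val this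
    · rintro ⟨h', rfl⟩
      ext x
      exact H.apply_apply_eq_zero (h' x)

theorem homLength_of_subsingleton [Subsingleton N] : homLength k A X N = 0 :=
  let _ : Module k N := Module.restrictScalars k A N
  have : IsScalarTower k A N := IsScalarTower.restrictScalars k A N
  Module.length_eq_zero

theorem homLength_self_of_isSimpleModule [IsAlgClosed k] [FiniteDimensional k A]
    [IsSimpleModule A X] : homLength k A X X = 1 := by
  let _ : Module k X := Module.restrictScalars k A X
  have : IsScalarTower k A X := IsScalarTower.restrictScalars k A X
  have : FiniteDimensional k X := Module.Finite.trans A X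
  have h := IsSimpleModule.algebraMap_end_bijective_of_isAlgClosed (A := A) (V := X) k
  exact (LinearEquiv.length_eq
    (LinearEquiv.ofBijective (Algebra.linearMap k (Module.End A X)) h)).symm.trans
    (Module.length_eq_one k k)

end HomLength

/-! ### Multiplicities from functions on the submodule lattice -/

section Multiplicities

variable {A : Type u} [Ring A]

open Classical in
/-- A function on submodules which, along a composition series, increases by one exactly at the
factors isomorphic to `S` computes the multiplicity of `S`. -/
theorem compMult_eq_of_covBy {M : Type*} [AddCommGroup M] [Module A M]
    [IsNoetherian A M] [IsArtinian A M]
    (S : Type*) [AddCommGroup S] [Module A S] (F : Submodule A M → ℕ∞) (h₀ : F ⊥ = 0)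
    (h₁ : ∀ N₁ N₂ : Submodule A M, N₁ ⋖ N₂ → F N₂ = F N₁ +
      if Nonempty ((N₂ ⧸ N₁.comap N₂.subtype) ≃ₗ[A] S) then 1 else 0) :
    (compMult A M S : ℕ∞) = F ⊤ := by
  obtain ⟨s, hs₀, hs₁⟩ := exists_compositionSeries_of_isNoetherian_isArtinian A M
  rw [compMult_eq A S s hs₀ hs₁, countFactors, ← hs₁, Nat.card_eq_fintype_card,
    Fintype.card_subtype, Finset.card_filter]
  have key : ∀ n (hn : n ≤ s.length), F (s ⟨n, Nat.lt_succ_of_le hn⟩) =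
      ∑ i : Fin n, if Nonempty (factor A s ⟨i, i.2.trans_le hn⟩ ≃ₗ[A] S) then (1 : ℕ∞) else 0 := by
    intro n
    induction n with
    | zero => exact fun _ => (congrArg F hs₀).trans h₀
    | succ n ih =>
      intro hn
      rw [Fin.sum_univ_castSucc]
      exact (h₁ _ _ (s.step ⟨n, hn⟩)).trans (congrArg₂ _ (ih (Nat.le_of_succ_le hn)) rfl)
  have := key s.length le_rfl
  push_cast
  exact this.symm

end Multiplicities

/-! ### Maps out of projective covers -/

section ProjectiveCovers

variable (k : Type v) [Field k] [IsAlgClosed k] {A : Type u} [Ring A] [Algebra k A]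
  [FiniteDimensional k A]

/-- Any lift of a nonzero element of `L` generates `P`: its span together with the superfluous
kernel is everything. -/
theorem IsProjectiveCover.finite {P L : Type u} [AddCommGroup P] [Module A P]
    [AddCommGroup L] [Module A L] {p : P →ₗ[A] L} (hp : IsProjectiveCover A p)
    [IsSimpleModule A L] : Module.Finite A P := by
  have := IsSimpleModule.nontrivial A L
  obtain ⟨y, hy⟩ := exists_ne (0 : L)
  obtain ⟨x, rfl⟩ := hp.surjective y
  have h : Submodule.span A {x} = ⊤ := by
    refine hp.superfluous _ (eq_top_iff.2 fun z _ => ?_)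
    obtain ⟨a, ha⟩ := IsSimpleModule.toSpanSingleton_surjective A hy (p z)
    refine Submodule.mem_sup.2 ⟨a • x, Submodule.smul_mem _ _ (Submodule.mem_span_singleton_self x),
      z - a • x, ?_, by abel⟩
    rw [LinearMap.mem_ker, map_sub, map_smul, sub_eq_zero]
    exact ha.symm
  exact ⟨⟨{x}, by simpa using h⟩⟩

/-- The kernel of a nonzero map to a simple module is maximal. If it missed part of `ker p`, the two
would span `P`, against superfluity. -/
theorem IsProjectiveCover.ker_le {P L : Type u} [AddCommGroup P] [Module A P]
    [AddCommGroup L] [Module A L] {p : P →ₗ[A] L} (hp : IsProjectiveCover A p)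
    {S : Type*} [AddCommGroup S] [Module A S] [IsSimpleModule A S] (f : P →ₗ[A] S) :
    LinearMap.ker p ≤ LinearMap.ker f := by
  by_cases h0 : f = 0
  · simp [h0]
  have hc : IsCoatom (LinearMap.ker f) :=
    LinearMap.isCoatom_ker_of_surjective (LinearMap.surjective_of_ne_zero h0)
  by_contra h
  exact hc.1 (hp.superfluous _ (hc.2 _ (left_lt_sup.2 h)))

-- Every map `P → S` factors through `L`, so this is Schur's lemma over an algebraically closed
-- field.
open Classical in
theorem homLength_projectiveCover_simple {P L S : Type u} [AddCommGroup P] [Module A P]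
    [AddCommGroup L] [Module A L] {p : P →ₗ[A] L} (hp : IsProjectiveCover A p)
    [IsSimpleModule A L] [AddCommGroup S] [Module A S] [IsSimpleModule A S] :
    homLength k A P S = if Nonempty (S ≃ₗ[A] L) then 1 else 0 := by
  rw [← homLength_eq_of_surjective k p hp.surjective fun f => hp.ker_le f]
  split_ifs with h
  · obtain ⟨e⟩ := h
    rw [homLength_congr_right k e]
    exact homLength_self_of_isSimpleModule k
  · have : Subsingleton (L →ₗ[A] S) := by
      refine ⟨fun f g => ?_⟩
      have key : ∀ f : L →ₗ[A] S, f = 0 := fun f =>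
        (LinearMap.bijective_or_eq_zero f).resolve_left fun hf =>
          h ⟨(LinearEquiv.ofBijective f hf).symm⟩
      rw [key f, key g]
    let _ : Module k S := Module.restrictScalars k A S
    have : IsScalarTower k A S := IsScalarTower.restrictScalars k A S
    exact Module.length_eq_zero

end ProjectiveCovers

/-! ### Contravariant self-dualities and the radical -/

section Duality

/-- A contravariant exact functor `obj`, from finitely generated `A`-modules to `A`-modules, which
fixes simple modules and is adjoint to itself, at the level of dimensions. -/
structure SelfDuality (k : Type v) [Field k] (A : Type u) [Ring A] [Algebra k A] where
  -- The target universe is free, since the `k`-dual of a module also involves the universe of `k`.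
  obj : FGModuleCat.{u} A → ModuleCat.{w} A
  map : ∀ {X Y : FGModuleCat.{u} A}, (X →ₗ[A] Y) → (obj Y →ₗ[A] obj X)
  map_id : ∀ X : FGModuleCat.{u} A, map (LinearMap.id : X →ₗ[A] X) = LinearMap.id
  map_comp : ∀ {X Y Z : FGModuleCat.{u} A} (f : X →ₗ[A] Y) (g : Y →ₗ[A] Z),
    map (g ∘ₗ f) = map f ∘ₗ map g
  map_zero : ∀ X Y : FGModuleCat.{u} A, map (0 : X →ₗ[A] Y) = 0
  exact : ∀ {X Y Z : FGModuleCat.{u} A} (f : X →ₗ[A] Y) (g : Y →ₗ[A] Z),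
    Function.Exact f g → Function.Exact (map g) (map f)
  simple : ∀ X : FGModuleCat.{u} A, IsSimpleModule A X → Nonempty (obj X ≃ₗ[A] X)
  -- Exchanging `X` and `Y` turns this into an equality.
  homLength_le : ∀ X Y : FGModuleCat.{u} A, homLength k A X (obj Y) ≤ homLength k A Y (obj X)

namespace SelfDuality

variable {k : Type v} [Field k] {A : Type u} [Ring A] [Algebra k A]
  (D : SelfDuality.{u, v, w} k A) {X Y Z : FGModuleCat.{u} A}

theorem map_injective (f : X →ₗ[A] Y) (hf : Function.Surjective f) :
    Function.Injective (D.map f) := by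
  have h : Function.Exact f (0 : Y →ₗ[A] Y) := fun y => by simpa using hf y
  have := D.exact f _ h
  rw [D.map_zero] at this
  rw [← LinearMap.ker_eq_bot, LinearMap.exact_iff.1 this, LinearMap.range_zero]

theorem map_surjective (f : X →ₗ[A] Y) (hf : Function.Injective f) :
    Function.Surjective (D.map f) := by
  have h : Function.Exact (0 : X →ₗ[A] X) f := fun x => by
    simpa [eq_comm] using map_eq_zero_iff f hf
  have := D.exact _ f h
  rw [D.map_zero] at this
  intro y
  exact (this y).1 rfl

theorem subsingleton_obj (X : FGModuleCat.{u} A) [Subsingleton X] : Subsingleton (D.obj X) := by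
  have h0 : (LinearMap.id : X →ₗ[A] X) = 0 := Subsingleton.elim _ _
  refine ⟨fun y z => ?_⟩
  have h := D.map_id X
  rw [h0, D.map_zero] at h
  rw [← LinearMap.id_apply (R := A) y, ← LinearMap.id_apply (R := A) z, ← h]
  rfl

/-- Induction on the length. For `X = N ⊕ C`, elements of `J·DX` restrict to zero in `DN` and `DC`.
By exactness, an element vanishing in `DN` comes from `DC`, and `DC → DX → DC` is the identity, so
the element is zero. -/
theorem jacobson_smul_obj_of_isSemisimpleModule [IsArtinianRing A] (X : FGModuleCat.{u} A)
    [IsSemisimpleModule A X] : Ring.jacobson A • (⊤ : Submodule A (D.obj X)) = ⊥ := by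
  induction h : Module.length A X using WellFoundedLT.induction generalizing X with
  | ind n ih =>
  have hsub : ∀ N : Submodule A X, N ≠ ⊤ →
      Ring.jacobson A • (⊤ : Submodule A (D.obj (FGModuleCat.of A N))) = ⊥ := fun N hN =>
    have : IsSemisimpleModule A (FGModuleCat.of A N) := inferInstanceAs (IsSemisimpleModule A N)
    ih _ (h ▸ Submodule.length_lt hN) (FGModuleCat.of A N) rfl
  by_cases hs : ∃ N : Submodule A X, N ≠ ⊥ ∧ N ≠ ⊤
  · obtain ⟨N, hb, ht⟩ := hs
    obtain ⟨C, hC⟩ := exists_isCompl N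
    have hCt : C ≠ ⊤ := by
      rintro rfl
      exact hb (disjoint_top.1 hC.disjoint)
    let ι₁ : FGModuleCat.of A N →ₗ[A] X := N.subtype
    let ι₂ : FGModuleCat.of A C →ₗ[A] X := C.subtype
    let π₂ : X →ₗ[A] FGModuleCat.of A C := C.projectionOnto N hC.symm
    have hex : Function.Exact ι₁ π₂ := by
      rw [LinearMap.exact_iff]
      simp [ι₁, π₂]
    have hid : π₂ ∘ₗ ι₂ = LinearMap.id := by
      ext x
      simp [ι₂, π₂]
    rw [eq_bot_iff, Submodule.smul_le]
    intro a ha y _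
    have h₁ : D.map ι₁ (a • y) = 0 := by
      have := Submodule.smul_mem_smul ha (Submodule.mem_top (x := D.map ι₁ y))
      rw [hsub N ht] at this
      rw [map_smul]; exact this
    have h₂ : D.map ι₂ (a • y) = 0 := by
      have := Submodule.smul_mem_smul ha (Submodule.mem_top (x := D.map ι₂ y))
      rw [hsub C hCt] at this
      rw [map_smul]; exact this
    obtain ⟨z, hz⟩ := (D.exact _ _ hex _).1 h₁
    have hz' : z = D.map ι₂ (D.map π₂ z) := by
      rw [← LinearMap.comp_apply, ← D.map_comp, hid, D.map_id, LinearMap.id_apply]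
    rw [hz, h₂] at hz'
    rw [Submodule.mem_bot, ← hz, hz']
    exact _root_.map_zero _
  · push Not at hs
    rcases subsingleton_or_nontrivial X with hX | hX
    · have := D.subsingleton_obj X
      exact Subsingleton.elim _ _
    · have : IsSimpleModule A X := { eq_bot_or_eq_top := fun N => or_iff_not_imp_left.2 (hs N) }
      obtain ⟨e⟩ := D.simple X this
      have := IsSimpleModule.congr e
      exact jacobson_smul_top_of_isSemisimpleModule A

/-- Put `R = JˢX`, which is semisimple when `Jˢ⁺¹X = 0`. In the exact sequence `D(X/R) → DX → DR`,
the ideal `J` kills `DR`, hence `J·DX` lies in the image of `D(X/R)`, which `Jˢ` kills by induction.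
-/
theorem jacobsonIter_obj [IsArtinianRing A] (s : ℕ) (X : FGModuleCat.{u} A)
    (hX : jacobsonIter A s (⊤ : Submodule A X) = ⊥) :
    jacobsonIter A s (⊤ : Submodule A (D.obj X)) = ⊥ := by
  induction s generalizing X with
  | zero =>
    have hs : Subsingleton X := (Submodule.subsingleton_iff A).1 (subsingleton_of_bot_eq_top hX.symm)
    have := D.subsingleton_obj X
    exact Subsingleton.elim _ _
  | succ s ih =>
    let R : Submodule A X := jacobsonIter A s ⊤
    let ι : FGModuleCat.of A R →ₗ[A] X := R.subtype
    let q : X →ₗ[A] FGModuleCat.of A (X ⧸ R) := R.mkQ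
    have hR : IsSemisimpleModule A (FGModuleCat.of A R) := by
      refine isSemisimpleModule_of_jacobson_smul_top A
        (Submodule.map_injective_of_injective R.subtype_injective ?_)
      rw [Submodule.map_smul'', Submodule.map_bot]
      rw [jacobsonIter_succ'] at hX
      simpa [R] using hX
    have hQ : jacobsonIter A s (⊤ : Submodule A (D.obj (FGModuleCat.of A (X ⧸ R)))) = ⊥ := by
      apply ih
      have := map_jacobsonIter A R.mkQ s ⊤
      rw [Submodule.map_top, Submodule.range_mkQ] at this
      refine this.symm.trans ?_
      rw [← le_bot_iff, Submodule.map_le_iff_le_comap, Submodule.comap_bot, Submodule.ker_mkQ]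
    have hJ := D.jacobson_smul_obj_of_isSemisimpleModule (FGModuleCat.of A R)
    have hex : Function.Exact (D.map q) (D.map ι) := D.exact _ _ (by
      rw [LinearMap.exact_iff]; simp [ι, q])
    have hle : Ring.jacobson A • (⊤ : Submodule A (D.obj X)) ≤ LinearMap.range (D.map q) := by
      rw [← LinearMap.exact_iff.1 hex, LinearMap.ker, ← Submodule.map_le_iff_le_comap,
        Submodule.map_smul'']
      exact (smul_mono_right _ le_top).trans hJ.le
    rw [jacobsonIter_succ, eq_bot_iff]
    refine (jacobsonIter_mono A s hle).trans ?_
    rw [← Submodule.map_top, ← map_jacobsonIter, hQ, Submodule.map_bot]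

end SelfDuality

end Duality

/-! ### Reciprocity for an algebra with a self-duality -/

section Reciprocity

variable {k : Type v} [Field k] [IsAlgClosed k] {A : Type u} [Ring A] [Algebra k A]
  [FiniteDimensional k A]

theorem isSimpleModule_of_covBy {M : Type*} [AddCommGroup M] [Module A M] {N₁ N₂ : Submodule A M}
    (h : N₁ ⋖ N₂) : IsSimpleModule A (N₂ ⧸ N₁.comap N₂.subtype) :=
  (covBy_iff_quot_is_simple h.le).1 h

-- `Hom(P, -)` is exact, and on simple modules it has dimension one at `L` and zero elsewhere.
variable (k) in
theorem compMult_eq_homLength {P L : Type u} [AddCommGroup P] [Module A P]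
    [AddCommGroup L] [Module A L] [IsSimpleModule A L] {p : P →ₗ[A] L}
    (hp : IsProjectiveCover A p) (X : Type u) [AddCommGroup X] [Module A X] [Module.Finite A X] :
    (compMult A X L : ℕ∞) = homLength k A P X := by
  have := IsArtinianRing.of_finite k A
  have := hp.projective
  rw [compMult_eq_of_covBy L (fun N => homLength k A P N) (homLength_of_subsingleton k) ?_]
  · exact homLength_congr_right k Submodule.topEquiv
  · intro N₁ N₂ h
    have := isSimpleModule_of_covBy h
    rw [← homLength_projectiveCover_simple k hp]
    refine homLength_eq_add_of_exact k (Submodule.inclusion h.le) (Submodule.mkQ _)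
      (Submodule.inclusion_injective h.le) (Submodule.mkQ_surjective _) ?_
    rw [LinearMap.exact_iff, Submodule.ker_mkQ, Submodule.range_inclusion]

/-- Additivity on `0 → radˢ X/radˢ⁺¹ X → X/radˢ⁺¹ X → X/radˢ X → 0`. -/
theorem compMult_radLayer_add (k : Type v) [Field k] [IsAlgClosed k] {A : Type u} [Ring A]
    [Algebra k A] [FiniteDimensional k A] {P L X : Type u} [AddCommGroup P] [Module A P]
    [AddCommGroup L] [Module A L] [IsSimpleModule A L] {p : P →ₗ[A] L}
    (hp : IsProjectiveCover A p) [AddCommGroup X] [Module A X] [Module.Finite A X]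
    (s : ℕ) : compMult A (X ⧸ radPow A X (s + 1)) L =
      compMult A (radLayer A X (s + 1)) L + compMult A (X ⧸ radPow A X s) L := by
  have := IsArtinianRing.of_finite k A
  have := hp.projective
  have hle : radPow A X (s + 1) ≤ radPow A X s := Submodule.map_subtype_le _ _
  rw [← ENat.natCast_inj, Nat.cast_add, compMult_eq_homLength k hp, compMult_eq_homLength k hp,
    compMult_eq_homLength k hp]
  refine homLength_eq_add_of_exact k
    (Submodule.mapQ ((radPow A X (s + 1)).comap (radPow A X s).subtype) _ (radPow A X s).subtype
      le_rfl) (Submodule.factor hle) ?_ (Submodule.factor_surjective hle) ?_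
  · rw [← LinearMap.ker_eq_bot, Submodule.ker_mapQ]
    exact (Submodule.mkQ_map_self _)
  · rw [LinearMap.exact_iff, Submodule.range_mapQ, Submodule.range_subtype]
    simp [Submodule.factor, Submodule.mapQ, Submodule.ker_liftQ]

/-- The function `N ↦ dim Hom(P, DN)` also counts `L`: for `N₁ ⋖ N₂` the dual of the simple factor
is a submodule of `DN₂` with quotient `DN₁`, and `D` fixes that factor. -/
theorem SelfDuality.compMult_eq_homLength (D : SelfDuality.{u, v, w} k A)
    {P L : Type u} [AddCommGroup P] [Module A P]
    [AddCommGroup L] [Module A L] [IsSimpleModule A L] {p : P →ₗ[A] L}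
    (hp : IsProjectiveCover A p) (X : FGModuleCat.{u} A) :
    (compMult A X L : ℕ∞) = homLength k A P (D.obj X) := by
  have := IsArtinianRing.of_finite k A
  have := hp.projective
  have h0 := D.subsingleton_obj (FGModuleCat.of A (⊥ : Submodule A X))
  rw [compMult_eq_of_covBy L (fun N : Submodule A X => homLength k A P (D.obj (FGModuleCat.of A N)))
    (homLength_of_subsingleton k) ?_]
  · let e : FGModuleCat.of A (⊤ : Submodule A X) ≃ₗ[A] X := Submodule.topEquiv
    refine homLength_congr_right k (LinearEquiv.ofLinearMap (D.map e.symm.toLinearMap)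
      (D.map e.toLinearMap) ?_ ?_)
    · rw [← D.map_comp, LinearEquiv.comp_coe, LinearEquiv.symm_trans_self]; exact D.map_id _
    · rw [← D.map_comp, LinearEquiv.comp_coe, LinearEquiv.self_trans_symm]; exact D.map_id _
  · intro N₁ N₂ h
    have := isSimpleModule_of_covBy h
    let ι : FGModuleCat.of A N₁ →ₗ[A] FGModuleCat.of A N₂ := Submodule.inclusion h.le
    let q : FGModuleCat.of A N₂ →ₗ[A] FGModuleCat.of A (N₂ ⧸ N₁.comap N₂.subtype) :=
      Submodule.mkQ _
    have hex : Function.Exact ι q := by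
      rw [LinearMap.exact_iff]
      exact (Submodule.ker_mkQ _).trans (Submodule.range_inclusion _ _ h.le).symm
    obtain ⟨e⟩ := D.simple (FGModuleCat.of A (N₂ ⧸ N₁.comap N₂.subtype)) this
    rw [← homLength_projectiveCover_simple k hp, add_comm, ← homLength_congr_right k e]
    exact homLength_eq_add_of_exact k (D.map q) (D.map ι)
      (D.map_injective q (Submodule.mkQ_surjective _))
      (D.map_surjective ι (Submodule.inclusion_injective h.le)) (D.exact _ _ hex)

theorem SelfDuality.compMult_quotient_radPow_le (D : SelfDuality.{u, v, w} k A)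
    {P L P' L' : Type u} [AddCommGroup P] [Module A P] [AddCommGroup L] [Module A L]
    [IsSimpleModule A L] {p : P →ₗ[A] L} (hp : IsProjectiveCover A p)
    [AddCommGroup P'] [Module A P'] [AddCommGroup L'] [Module A L']
    [IsSimpleModule A L'] {p' : P' →ₗ[A] L'} (hp' : IsProjectiveCover A p') (s : ℕ) :
    compMult A (P' ⧸ radPow A P' s) L ≤ compMult A (P ⧸ radPow A P s) L' := by
  have := IsArtinianRing.of_finite k A
  have := hp.finite
  have := hp'.finite
  have hkill : ∀ Q : Type u, ∀ [AddCommGroup Q] [Module A Q] [Module.Finite A Q],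
      jacobsonIter A s (⊤ : Submodule A (D.obj (FGModuleCat.of A (Q ⧸ radPow A Q s)))) = ⊥ := by
    intro Q _ _ _
    apply D.jacobsonIter_obj
    have := map_jacobsonIter A (radPow A Q s).mkQ s ⊤
    rw [Submodule.map_top, Submodule.range_mkQ] at this
    refine this.symm.trans ?_
    rw [← radPow_eq_jacobsonIter, ← le_bot_iff, Submodule.map_le_iff_le_comap, Submodule.comap_bot,
      Submodule.ker_mkQ]
  -- Maps from `P` to a module killed by `Jˢ` factor through `P/radˢ P`.
  have key : homLength k A (P ⧸ radPow A P s) (D.obj (FGModuleCat.of A (P' ⧸ radPow A P' s))) =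
      homLength k A P (D.obj (FGModuleCat.of A (P' ⧸ radPow A P' s))) := by
    refine homLength_eq_of_surjective k (radPow A P s).mkQ (Submodule.mkQ_surjective _) fun f => ?_
    rw [Submodule.ker_mkQ, LinearMap.ker, ← Submodule.map_le_iff_le_comap]
    refine (congrArg (Submodule.map f) (radPow_eq_jacobsonIter A s)).le.trans ?_
    rw [map_jacobsonIter]
    exact (jacobsonIter_mono A s le_top).trans (hkill P').le
  rw [← ENat.natCast_le_natCast, D.compMult_eq_homLength hp (FGModuleCat.of A (P' ⧸ radPow A P' s)),
    D.compMult_eq_homLength hp' (FGModuleCat.of A (P ⧸ radPow A P s)), ← key]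
  exact (D.homLength_le (FGModuleCat.of A (P ⧸ radPow A P s)) _).trans
    (homLength_le_of_surjective k (radPow A P' s).mkQ (Submodule.mkQ_surjective _))

theorem SelfDuality.compMult_radLayer_eq (D : SelfDuality.{u, v, w} k A)
    {P L P' L' : Type u} [AddCommGroup P] [Module A P] [AddCommGroup L] [Module A L]
    [IsSimpleModule A L] {p : P →ₗ[A] L} (hp : IsProjectiveCover A p)
    [AddCommGroup P'] [Module A P'] [AddCommGroup L'] [Module A L']
    [IsSimpleModule A L'] {p' : P' →ₗ[A] L'} (hp' : IsProjectiveCover A p') {s : ℕ} (hs : 1 ≤ s) :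
    compMult A (radLayer A P' s) L = compMult A (radLayer A P s) L' := by
  obtain ⟨s, rfl⟩ := Nat.exists_eq_add_of_le' hs
  have := hp.finite
  have := hp'.finite
  have h₁ := compMult_radLayer_add k hp (X := P') s
  have h₂ := compMult_radLayer_add k hp' (X := P) s
  have h₃ : ∀ s, compMult A (P' ⧸ radPow A P' s) L = compMult A (P ⧸ radPow A P s) L' := fun s =>
    le_antisymm (D.compMult_quotient_radPow_le hp hp' s) (D.compMult_quotient_radPow_le hp' hp s)
  rw [h₃, h₃] at h₁
  exact Nat.add_right_cancel (h₁.symm.trans h₂)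

end Reciprocity

/-! ### The self-duality of a BGG algebra -/

section BGGDuality

variable {k : Type v} [Field k] {A : Type u} [Ring A] [Algebra k A]

/-- A duality fixing the simple modules, as a `SelfDuality`. -/
noncomputable def IsDuality.selfDuality {δ : (FGModuleCat.{u} A)ᵒᵖ ⥤ FGModuleCat.{u} A}
    (hδ : IsDuality k A δ)
    (hs : ∀ X : FGModuleCat.{u} A, IsSimpleModule A X →
      Nonempty (δ.obj (Opposite.op X) ≃ₗ[A] X)) : SelfDuality.{u, v, u} k A where
  obj X := (δ.obj (Opposite.op X)).obj
  map {X Y} f := (δ.map (FGModuleCat.ofHom f : X ⟶ Y).op).hom.hom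
  map_id X := by
    have : (FGModuleCat.ofHom (LinearMap.id : X →ₗ[A] X) : X ⟶ X) = 𝟙 X := rfl
    rw [this, op_id, δ.map_id]
    rfl
  map_comp {X Y Z} f g := by
    have : (FGModuleCat.ofHom (g ∘ₗ f) : X ⟶ Z) =
      (FGModuleCat.ofHom f : X ⟶ Y) ≫ (FGModuleCat.ofHom g : Y ⟶ Z) := rfl
    rw [this, op_comp, δ.map_comp]
    rfl
  map_zero X Y := by
    have := hδ.additive
    have h : (FGModuleCat.ofHom (0 : X →ₗ[A] Y) : X ⟶ Y).op = 0 := rfl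
    rw [h, δ.map_zero]
    rfl
  exact {X Y Z} f g h := hδ.exact (FGModuleCat.ofHom f : X ⟶ Y) (FGModuleCat.ofHom g : Y ⟶ Z) h
  simple := hs
  homLength_le X Y := by
    obtain ⟨η⟩ := hδ.square
    have := hδ.additive
    have hf : (δ.rightOp ⋙ δ).Faithful := Functor.Faithful.of_iso η.symm
    have hf' : δ.rightOp.Faithful := Functor.Faithful.of_comp _ δ
    -- The adjunct of `f : X → δY` is `Y ≅ δδY → δX`. It determines `f` because `δ` is faithful, its
    -- square being isomorphic to the identity.
    let F : (X ⟶ δ.obj (Opposite.op Y)) → (Y ⟶ δ.obj (Opposite.op X)) :=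
      fun f => η.inv.app Y ≫ δ.map f.op
    refine homLength_le_of_injective k
      ⟨⟨fun f => (F (FGModuleCat.ofHom f)).hom.hom, ?_⟩, fun f g => ?_⟩ ?_ ?_
    · have h : (FGModuleCat.ofHom (0 : X →ₗ[A] δ.obj (Opposite.op Y)) :
        X ⟶ δ.obj (Opposite.op Y)).op = 0 := rfl
      simp only [F]
      rw [h, δ.map_zero, Limits.comp_zero]
      rfl
    · have h : (FGModuleCat.ofHom (f + g) : X ⟶ δ.obj (Opposite.op Y)).op =
        (FGModuleCat.ofHom f : X ⟶ δ.obj (Opposite.op Y)).op +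
          (FGModuleCat.ofHom g : X ⟶ δ.obj (Opposite.op Y)).op := rfl
      simp only [F]
      rw [h, δ.map_add, Preadditive.comp_add]
      rfl
    · intro f g h
      have h₁ : F (FGModuleCat.ofHom f) = F (FGModuleCat.ofHom g) := FGModuleCat.hom_ext h
      have h₂ := (cancel_epi (η.inv.app Y)).1 h₁
      have h₃ : (FGModuleCat.ofHom f : X ⟶ δ.obj (Opposite.op Y)) = FGModuleCat.ofHom g :=
        δ.rightOp.map_injective (Quiver.Hom.unop_inj h₂)
      exact congrArg (fun φ => φ.hom.hom) h₃
    · intro c f g h y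
      have h₁ : (FGModuleCat.ofHom g : X ⟶ δ.obj (Opposite.op Y)) =
          c • (FGModuleCat.ofHom f : X ⟶ δ.obj (Opposite.op Y)) :=
        FGModuleCat.hom_ext (LinearMap.ext h)
      have h₂ : F (FGModuleCat.ofHom g) = c • F (FGModuleCat.ofHom f) := by
        simp only [F]
        rw [h₁, hδ.linear, Linear.comp_smul]
      exact congrArg (fun φ : Y ⟶ δ.obj (Opposite.op X) => φ.hom.hom y) h₂

theorem IsBGG.exists_selfDuality {π : Type w} [PartialOrder π] {L P : π → Type u}
    [∀ a, AddCommGroup (L a)] [∀ a, Module A (L a)]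
    [∀ a, AddCommGroup (P a)] [∀ a, Module A (P a)]
    (hL : IsFullSetOfSimples A L) (h : IsBGG k A L P) :
    Nonempty (SelfDuality.{u, v, u} k A) := by
  obtain ⟨δ, hδ, hδL⟩ := h.duality
  refine ⟨hδ.selfDuality fun X hX => ?_⟩
  obtain ⟨a, ⟨e⟩⟩ := hL.complete X hX
  obtain ⟨e'⟩ := hδL a X ⟨e⟩
  exact ⟨e'.trans e.symm⟩

end BGGDuality

/-! ### Cellular algebras: the dual twisted by the anti-involution -/

namespace CellDatum

attribute [instance] CellDatum.partialOrder CellDatum.finite_Λ CellDatum.fintype_M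

variable {k : Type v} [Field k] {A : Type u} [Ring A] [Algebra k A] (c : CellDatum.{u, v, w'} k A)

theorem finiteDimensional (c : CellDatum.{u, v, w'} k A) : FiniteDimensional k A :=
  Module.Finite.of_basis c.C

theorem i_one : c.i 1 = 1 := by
  have h := c.i_mul (c.i 1) 1
  rwa [mul_one, c.i_i, mul_one, eq_comm] at h

theorem i_algebraMap (x : k) : c.i (algebraMap k A x) = algebraMap k A x := by
  rw [Algebra.algebraMap_eq_smul_one, map_smul, i_one]

section TwistedDual

/-- The `k`-dual of an `A`-module, on which `A` acts through the anti-involution. -/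
def TwistedDual (_c : CellDatum.{u, v, w'} k A) (Y : Type*) [AddCommGroup Y] [Module A Y] :
    Type _ :=
  letI : Module k Y := Module.restrictScalars k A Y
  Module.Dual k Y

variable (Y : Type*) [AddCommGroup Y] [Module A Y]

instance : AddCommGroup (c.TwistedDual Y) :=
  letI : Module k Y := Module.restrictScalars k A Y
  (LinearMap.addCommGroup : AddCommGroup (Module.Dual k Y))

instance : FunLike (c.TwistedDual Y) Y k :=
  letI : Module k Y := Module.restrictScalars k A Y
  (LinearMap.instFunLike : FunLike (Module.Dual k Y) Y k)

variable {Y}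

@[ext] theorem TwistedDual.ext {f g : c.TwistedDual Y} (h : ∀ y, f y = g y) : f = g :=
  DFunLike.ext f g h

variable {c}

@[simp] theorem TwistedDual.add_apply (f g : c.TwistedDual Y) (y : Y) : (f + g) y = f y + g y := rfl

@[simp] theorem TwistedDual.zero_apply (y : Y) : (0 : c.TwistedDual Y) y = 0 := rfl

theorem TwistedDual.map_add (f : c.TwistedDual Y) (x y : Y) : f (x + y) = f x + f y :=
  letI : Module k Y := Module.restrictScalars k A Y
  LinearMap.map_add (show Module.Dual k Y from f) x y

theorem TwistedDual.map_zero (f : c.TwistedDual Y) : f 0 = 0 :=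
  letI : Module k Y := Module.restrictScalars k A Y
  LinearMap.map_zero (show Module.Dual k Y from f)

theorem TwistedDual.map_algebraMap_smul (f : c.TwistedDual Y) (x : k) (y : Y) :
    f (algebraMap k A x • y) = x * f y :=
  letI : Module k Y := Module.restrictScalars k A Y
  LinearMap.map_smul (show Module.Dual k Y from f) x y

/-- The constructor of elements of the twisted dual. -/
def TwistedDual.mk (f : Y → k) (h₁ : ∀ x y, f (x + y) = f x + f y)
    (h₂ : ∀ (x : k) (y : Y), f (algebraMap k A x • y) = x * f y) : c.TwistedDual Y :=
  letI : Module k Y := Module.restrictScalars k A Y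
  show Module.Dual k Y from ⟨⟨f, h₁⟩, h₂⟩

@[simp] theorem TwistedDual.mk_apply (f : Y → k) (h₁ : ∀ x y, f (x + y) = f x + f y)
    (h₂ : ∀ (x : k) (y : Y), f (algebraMap k A x • y) = x * f y) (y : Y) :
    (TwistedDual.mk f h₁ h₂ : c.TwistedDual Y) y = f y := rfl

theorem TwistedDual.map_i_commute (f : c.TwistedDual Y) (a : A) (x : k) (y : Y) :
    f (a • algebraMap k A x • y) = x * f (a • y) := by
  rw [← mul_smul, ← Algebra.commutes, mul_smul, map_algebraMap_smul]

instance : SMul A (c.TwistedDual Y) where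
  smul a f := TwistedDual.mk (fun y => f (c.i a • y))
    (fun x y => by rw [smul_add, TwistedDual.map_add])
    (fun x y => f.map_i_commute _ x y)

@[simp] theorem TwistedDual.smul_apply (a : A) (f : c.TwistedDual Y) (y : Y) :
    (a • f) y = f (c.i a • y) := rfl

instance : Module A (c.TwistedDual Y) where
  one_smul f := by ext y; simp [c.i_one]
  mul_smul a b f := by ext y; simp [c.i_mul, mul_smul]
  smul_zero a := by ext y; simp
  smul_add a f g := by ext y; simp
  add_smul a b f := by ext y; simp [add_smul, TwistedDual.map_add]
  zero_smul f := by ext y; simp [TwistedDual.map_zero]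

variable (c)

/-- The transpose of a linear map. -/
def dualMap {X Y : Type*} [AddCommGroup X] [Module A X] [AddCommGroup Y] [Module A Y]
    (f : X →ₗ[A] Y) : c.TwistedDual Y →ₗ[A] c.TwistedDual X where
  toFun h := TwistedDual.mk (fun x => h (f x)) (fun x y => by rw [_root_.map_add, h.map_add])
    (fun x y => by rw [map_smul, h.map_algebraMap_smul])
  map_add' h h' := rfl
  map_smul' a h := by ext x; simp

@[simp] theorem dualMap_apply {X Y : Type*} [AddCommGroup X] [Module A X] [AddCommGroup Y]
    [Module A Y] (f : X →ₗ[A] Y) (h : c.TwistedDual Y) (x : X) : c.dualMap f h x = h (f x) := rfl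

theorem exact_dualMap {X Y Z : Type*} [AddCommGroup X] [Module A X] [AddCommGroup Y]
    [Module A Y] [AddCommGroup Z] [Module A Z] (f : X →ₗ[A] Y) (g : Y →ₗ[A] Z)
    (h : Function.Exact f g) : Function.Exact (c.dualMap g) (c.dualMap f) := by
  let _ : Module k X := Module.restrictScalars k A X
  have : IsScalarTower k A X := IsScalarTower.restrictScalars k A X
  let _ : Module k Y := Module.restrictScalars k A Y
  have : IsScalarTower k A Y := IsScalarTower.restrictScalars k A Y
  let _ : Module k Z := Module.restrictScalars k A Z
  have : IsScalarTower k A Z := IsScalarTower.restrictScalars k A Z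
  have hk : Function.Exact (f.restrictScalars k) (g.restrictScalars k) := h
  have : Function.Exact (g.restrictScalars k).dualMap (f.restrictScalars k).dualMap := by
    rw [LinearMap.exact_iff, LinearMap.ker_dualMap_eq_dualAnnihilator_range,
      LinearMap.range_dualMap_eq_dualAnnihilator_ker, LinearMap.exact_iff.1 hk]
  exact this

/-- Both sides describe pairings `B` of `X` and `Y` with `B(ax, y) = B(x, i(a)y)`. As `i` is an
involution, this condition is symmetric in the two arguments. -/
theorem homLength_twistedDual_le {X Y : Type*} [AddCommGroup X] [Module A X] [AddCommGroup Y]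
    [Module A Y] :
    homLength k A X (c.TwistedDual Y) ≤ homLength k A Y (c.TwistedDual X) := by
  have hi : ∀ (f : X →ₗ[A] c.TwistedDual Y) (a : A) (x : X) (y : Y),
      f (a • x) y = f x (c.i a • y) := fun f a x y => by rw [map_smul, TwistedDual.smul_apply]
  refine homLength_le_of_injective k
    ⟨⟨fun f =>
      { toFun := fun y => TwistedDual.mk (fun x => f x y) (fun x x' => by simp)
          fun r x => by rw [hi, i_algebraMap, TwistedDual.map_algebraMap_smul]
        map_add' := fun y y' => by ext x; simp [TwistedDual.map_add]
        map_smul' := fun a y => by ext x; simp [c.i_i] }, ?_⟩, ?_⟩ ?_ ?_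
  · rfl
  · intro f g; rfl
  · intro f g h
    ext x y
    exact congrArg (fun φ : Y →ₗ[A] c.TwistedDual X => φ y x) h
  · intro r f g h y
    ext x
    change g x y = f (c.i (algebraMap k A r) • x) y
    rw [h, hi, c.i_i]
    simp [c.i_algebraMap]

/-- The common zeros `V ⊆ L` of a proper submodule `N` of the dual form an `A`-submodule, nonzero by
double annihilators in finite dimension. Hence `V = L` and `N = 0`. -/
theorem isSimpleModule_twistedDual (L : Type*) [AddCommGroup L] [Module A L] [IsSimpleModule A L] :
    IsSimpleModule A (c.TwistedDual L) := by
  let _ : Module k L := Module.restrictScalars k A L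
  have : IsScalarTower k A L := IsScalarTower.restrictScalars k A L
  have := c.finiteDimensional
  have : FiniteDimensional k L := Module.Finite.trans A L
  have := IsSimpleModule.nontrivial A L
  have : Nontrivial (c.TwistedDual L) := inferInstanceAs (Nontrivial (Module.Dual k L))
  refine { eq_bot_or_eq_top := fun N => or_iff_not_imp_right.2 fun hN => ?_ }
  let Nk : Submodule k (Module.Dual k L) :=
    { carrier := {f | (show c.TwistedDual L from f) ∈ N}
      add_mem' := fun ha hb => N.add_mem ha hb
      zero_mem' := N.zero_mem
      smul_mem' := fun r f hf => by
        have : (show c.TwistedDual L from r • f) =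
            algebraMap k A r • (show c.TwistedDual L from f) := by
          ext x
          rw [TwistedDual.smul_apply, i_algebraMap, TwistedDual.map_algebraMap_smul]
          rfl
        rw [Set.mem_ofPred_eq, this]
        exact N.smul_mem _ hf }
  have hNk : Nk ≠ ⊤ := fun h => hN (eq_top_iff.2 fun f _ => (h.ge Submodule.mem_top : _ ∈ Nk))
  let V : Submodule A L :=
    { carrier := {x | ∀ f ∈ N, f x = 0}
      add_mem' := fun ha hb f hf => by rw [f.map_add, ha f hf, hb f hf, add_zero]
      zero_mem' := fun f _ => f.map_zero
      smul_mem' := fun a x hx f hf => by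
        have := hx _ (N.smul_mem (c.i a) hf)
        rwa [TwistedDual.smul_apply, c.i_i] at this }
  have hV : V ≠ ⊥ := by
    intro h
    apply hNk
    rw [← Subspace.dualCoannihilator_dualAnnihilator_eq (W := Nk)]
    have : Nk.dualCoannihilator = ⊥ := by
      rw [eq_bot_iff]
      intro x hx
      have : x ∈ V := fun f hf => (Submodule.mem_dualCoannihilator x).1 hx f hf
      rwa [h] at this
    rw [this, Submodule.dualAnnihilator_bot]
  have hV' : V = ⊤ := (eq_bot_or_eq_top V).resolve_left hV
  rw [eq_bot_iff]
  intro f hf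
  have : f = 0 := by
    ext x
    exact (hV'.ge (Submodule.mem_top : x ∈ ⊤) : x ∈ V) f hf
  exact this

end TwistedDual

/-! ### Cell modules, their forms, and simple modules -/

section Cells

/-- The span of the basis elements with upper index less than `l`. -/
def lower (l : c.Λ) : Submodule k A :=
  Submodule.span k {x | ∃ l' < l, ∃ X Y : c.M l', x = c.C ⟨l', X, Y⟩}

theorem i_mem_lower {l : c.Λ} {a : A} (ha : a ∈ c.lower l) : c.i a ∈ c.lower l := by
  induction ha using Submodule.span_induction with
  | mem x hx =>
    obtain ⟨l', h, X, Y, rfl⟩ := hx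
    rw [c.i_C]
    exact Submodule.subset_span ⟨l', h, Y, X, rfl⟩
  | zero => rw [map_zero]; exact zero_mem _
  | add x y _ _ hx hy => rw [map_add]; exact add_mem hx hy
  | smul r x _ hx => rw [map_smul]; exact Submodule.smul_mem _ _ hx

theorem C_mul (l : c.Λ) (a : A) (S T : c.M l) :
    c.C ⟨l, S, T⟩ * a - ∑ U, c.r l (c.i a) U T • c.C ⟨l, S, U⟩ ∈ c.lower l := by
  have := c.i_mem_lower (c.mul_C l (c.i a) T S)
  simpa only [map_sub, map_sum, map_smul, c.i_mul, c.i_C, c.i_i] using this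

open Classical in
theorem repr_of_mem_lower {l : c.Λ} {a : A} (ha : a ∈ c.lower l) (S T : c.M l) :
    c.C.repr a ⟨l, S, T⟩ = 0 := by
  induction ha using Submodule.span_induction with
  | mem x hx =>
    obtain ⟨l', h, X, Y, rfl⟩ := hx
    rw [c.C.repr_self, Finsupp.single_apply, if_neg]
    intro h'
    exact h.ne (congrArg Sigma.fst h')
  | zero => simp
  | add x y _ _ hx hy => simp [hx, hy]
  | smul r x _ hx => simp [hx]

-- Both sides are the coefficient of `C_{X,Y}` in `C_{S,T} C_{U,V}`, expanded by the left and by the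
-- right multiplication rule.
open Classical in
theorem r_C_aux (l : c.Λ) (S T U V X Y : c.M l) :
    (if Y = V then c.r l (c.C ⟨l, S, T⟩) X U else 0) =
      if X = S then c.r l (c.C ⟨l, V, U⟩) Y T else 0 := by
  have h₁ := c.repr_of_mem_lower (c.mul_C l (c.C ⟨l, S, T⟩) U V) X Y
  have h₂ := c.repr_of_mem_lower (c.C_mul l (c.C ⟨l, U, V⟩) S T) X Y
  rw [c.i_C] at h₂
  simp only [map_sub, map_sum, map_smul, Finsupp.sub_apply, Finsupp.finsetSum_apply,
    Finsupp.smul_apply, c.C.repr_self, Finsupp.single_apply, Sigma.mk.injEq, heq_eq_eq,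
    true_and, Prod.mk.injEq, smul_eq_mul, sub_eq_zero] at h₁ h₂
  have h₃ := h₁.symm.trans h₂
  simp only [mul_ite, mul_one, mul_zero, ite_and, Finset.sum_ite_eq', Finset.mem_univ,
    if_true] at h₃
  by_cases hY : Y = V <;> by_cases hX : X = S <;> simp_all [eq_comm]

/-- The bilinear form of a cell module, on its standard basis. -/
noncomputable def form (l : c.Λ) (T U : c.M l) : k := c.r l (c.C ⟨l, T, T⟩) T U

-- This is the relation `C_{S,T} C_{U,V} ≡ φ(T,U) C_{S,V}` modulo lower cells.
open Classical in
theorem r_C (l : c.Λ) (S T U X : c.M l) :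
    c.r l (c.C ⟨l, S, T⟩) X U = if X = S then c.form l T U else 0 := by
  have h₁ := c.r_C_aux l S T U T X T
  have h₂ := c.r_C_aux l T T U T T T
  rw [if_pos rfl] at h₁ h₂
  rw [h₁, form, h₂, if_pos rfl]

/-- The action of `a` on the cell module of `l`. -/
def cellAction (l : c.Λ) (a : A) (x : c.M l → k) : c.M l → k := fun U => ∑ S, c.r l a U S * x S

/-- `l` is the cell index attached to the simple module `L`. -/
structure IsApex (l : c.Λ) (L : Type*) [AddCommGroup L] [Module A L] : Prop where
  lower_smul : ∀ a ∈ c.lower l, ∀ x : L, a • x = 0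
  exists_ne : ∃ S T, ∃ x : L, c.C ⟨l, S, T⟩ • x ≠ 0

/-- Some basis element acts nontrivially, since `1` does; take a minimal index among all that do. -/
theorem exists_isApex (L : Type*) [AddCommGroup L] [Module A L] [Nontrivial L] :
    ∃ l, c.IsApex l L := by
  let s : Set c.Λ := {l | ∃ S T, ∃ x : L, c.C ⟨l, S, T⟩ • x ≠ 0}
  have hs : s.Nonempty := by
    by_contra h
    rw [Set.not_nonempty_iff_eq_empty] at h
    obtain ⟨x, hx⟩ := exists_ne (0 : L)
    apply hx
    have key : ∀ a : A, a • x = 0 := by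
      intro a
      have ha : a ∈ Submodule.span k (Set.range c.C) := c.C.mem_span a
      induction ha using Submodule.span_induction with
      | mem a ha =>
        obtain ⟨⟨l, S, T⟩, rfl⟩ := ha
        by_contra h'
        exact (h ▸ (⟨S, T, x, h'⟩ : l ∈ s) : l ∈ (∅ : Set c.Λ))
      | zero => exact zero_smul _ _
      | add a b _ _ ha hb => rw [add_smul, ha, hb, add_zero]
      | smul r a _ ha => rw [Algebra.smul_def, mul_smul, ha, smul_zero]
    rw [← one_smul A x, key]
  obtain ⟨l, hl, hmin⟩ := WellFounded.has_min (wellFounded_lt (α := c.Λ)) s hs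
  refine ⟨l, ⟨fun a ha x => ?_, hl⟩⟩
  induction ha using Submodule.span_induction with
  | mem a ha =>
    obtain ⟨l', h, X, Y, rfl⟩ := ha
    by_contra h'
    exact hmin l' ⟨X, Y, x, h'⟩ h
  | zero => exact zero_smul _ _
  | add a b _ _ ha hb => rw [add_smul, ha, hb, add_zero]
  | smul r a _ ha => rw [Algebra.smul_def, mul_smul, ha, smul_zero]

variable {c}

/-- The anti-involution preserves the lower span and exchanges `C_{S,T}` with `C_{T,S}`. -/
theorem IsApex.twistedDual {l : c.Λ} {L : Type*} [AddCommGroup L] [Module A L]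
    (h : c.IsApex l L) : c.IsApex l (c.TwistedDual L) where
  lower_smul a ha f := by
    ext x
    rw [TwistedDual.smul_apply, h.lower_smul _ (c.i_mem_lower ha), f.map_zero,
      TwistedDual.zero_apply]
  exists_ne := by
    let _ : Module k L := Module.restrictScalars k A L
    obtain ⟨S, T, x, hx⟩ := h.exists_ne
    obtain ⟨f, hf⟩ := Module.Projective.exists_dual_ne_zero k hx
    let g : c.TwistedDual L := TwistedDual.mk f (f.map_add) (fun r y => f.map_smul r y)
    refine ⟨T, S, g, fun h0 => hf ?_⟩
    have h₁ : (c.C ⟨l, T, S⟩ • g) x = 0 := congrArg (fun g' : c.TwistedDual L => g' x) h0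
    rwa [TwistedDual.smul_apply, c.i_C] at h₁

/-- The map sends the basis vector at `S` to `C_{S,T} y`, for fixed `T` and `y` with some `C_{S₀,T}
y ≠ 0`. Its image is a nonzero submodule of `L`. Its kernel is the radical of the form, which does
not depend on `L`, `T` or `y`. -/
theorem IsApex.exists_cellMap {l : c.Λ} {L : Type*} [AddCommGroup L] [Module A L] [Module k L]
    [IsScalarTower k A L] [IsSimpleModule A L] (h : c.IsApex l L) :
    ∃ f : (c.M l → k) →ₗ[k] L, Function.Surjective f ∧
      (∀ a x, f (c.cellAction l a x) = a • f x) ∧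
      ∀ x, f x = 0 ↔ ∀ V, ∑ U, c.form l V U * x U = 0 := by
  classical
  obtain ⟨S₀, T, y, hy⟩ := h.exists_ne
  let f : (c.M l → k) →ₗ[k] L := Fintype.linearCombination k (fun S => c.C ⟨l, S, T⟩ • y)
  have hf : ∀ x, f x = ∑ S, x S • c.C ⟨l, S, T⟩ • y := fun x => rfl
  have hact : ∀ a x, f (c.cellAction l a x) = a • f x := by
    intro a x
    have h₁ : ∀ S, a • c.C ⟨l, S, T⟩ • y = ∑ U, c.r l a U S • c.C ⟨l, U, T⟩ • y := by
      intro S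
      have := h.lower_smul _ (c.mul_C l a S T) y
      rw [sub_smul, sub_eq_zero, Finset.sum_smul, mul_smul] at this
      simpa only [smul_assoc] using this
    rw [hf, hf, Finset.smul_sum]
    simp only [cellAction, Finset.sum_smul, smul_comm a (_ : k), h₁, Finset.smul_sum]
    rw [Finset.sum_comm]
    simp only [mul_comm (c.r l a _ _), mul_smul]
  have hC : ∀ U V x, c.C ⟨l, U, V⟩ • f x =
      (∑ S, c.form l V S * x S) • c.C ⟨l, U, T⟩ • y := by
    intro U V x
    rw [← hact, hf, Finset.sum_eq_single U]
    · simp [cellAction, r_C]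
    · intro X _ hX
      simp [cellAction, r_C, hX]
    · simp
  refine ⟨f, ?_, hact, fun x => ⟨fun hx V => ?_, fun hx => ?_⟩⟩
  · let R : Submodule A L :=
      { carrier := Set.range f
        add_mem' := by rintro _ _ ⟨x, rfl⟩ ⟨x', rfl⟩; exact ⟨x + x', map_add _ _ _⟩
        zero_mem' := ⟨0, map_zero _⟩
        smul_mem' := by rintro a _ ⟨x, rfl⟩; exact ⟨_, hact a x⟩ }
    have hR : R ≠ ⊥ := by
      intro h0
      apply hy
      have : c.C ⟨l, S₀, T⟩ • y ∈ R := ⟨Pi.single S₀ 1, by simp [f]⟩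
      rwa [h0] at this
    have hR' : R = ⊤ := (eq_bot_or_eq_top R).resolve_left hR
    exact fun z => (hR'.ge Submodule.mem_top : z ∈ R)
  · have := hC S₀ V x
    rw [hx, smul_zero, eq_comm, smul_eq_zero] at this
    exact this.resolve_right hy
  -- The elements killed by the whole cell form a submodule, proper because `y` is not in it and
  -- therefore zero.
  · let R : Submodule A L :=
      { carrier := {z | ∀ U V, c.C ⟨l, U, V⟩ • z = 0}
        add_mem' := fun hz hz' U V => by rw [smul_add, hz, hz', add_zero]
        zero_mem' := fun U V => smul_zero _
        smul_mem' := fun a z hz U V => by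
          have := h.lower_smul _ (c.C_mul l a U V) z
          rw [sub_smul, sub_eq_zero, Finset.sum_smul, mul_smul] at this
          rw [this]
          refine Finset.sum_eq_zero fun W _ => ?_
          rw [smul_assoc, hz, smul_zero] }
    have hR : R ≠ ⊤ := fun h0 => hy ((h0.ge Submodule.mem_top : y ∈ R) S₀ T)
    have hR' : R = ⊥ := (eq_bot_or_eq_top R).resolve_right hR
    have : f x ∈ R := fun U V => by rw [hC, hx, zero_smul]
    rwa [hR'] at this

/-- Both modules are quotients of the cell module of `l` by the same kernel. -/
theorem IsApex.nonempty_linearEquiv {l : c.Λ} {L L' : Type*} [AddCommGroup L] [Module A L]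
    [IsSimpleModule A L] [AddCommGroup L'] [Module A L'] [IsSimpleModule A L']
    (h : c.IsApex l L) (h' : c.IsApex l L') : Nonempty (L ≃ₗ[A] L') := by
  let _ : Module k L := Module.restrictScalars k A L
  have : IsScalarTower k A L := IsScalarTower.restrictScalars k A L
  let _ : Module k L' := Module.restrictScalars k A L'
  have : IsScalarTower k A L' := IsScalarTower.restrictScalars k A L'
  obtain ⟨f, hf, hact, hker⟩ := h.exists_cellMap
  obtain ⟨f', hf', hact', hker'⟩ := h'.exists_cellMap
  have hk : LinearMap.ker f = LinearMap.ker f' := by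
    ext x
    rw [LinearMap.mem_ker, LinearMap.mem_ker, hker, hker']
  let e : L ≃ₗ[k] L' := (f.quotKerEquivOfSurjective hf).symm ≪≫ₗ
    Submodule.quotEquivOfEq _ _ hk ≪≫ₗ f'.quotKerEquivOfSurjective hf'
  have he : ∀ x, e (f x) = f' x := by
    intro x
    have : (f.quotKerEquivOfSurjective hf).symm (f x) = (LinearMap.ker f).mkQ x := by
      rw [LinearEquiv.symm_apply_eq]; rfl
    simp [e, this]
  refine ⟨{ e with map_smul' := fun a z => ?_ }⟩
  obtain ⟨x, rfl⟩ := hf z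
  change e (a • f x) = a • e (f x)
  rw [← hact, he, he, hact']

end Cells

/-- The twisted dual of a cellular algebra, as a `SelfDuality`. -/
noncomputable def selfDuality (c : CellDatum.{u, v, w'} k A) : SelfDuality.{u, v, max u v} k A where
  obj X := ModuleCat.of A (c.TwistedDual X)
  map f := c.dualMap f
  map_id X := rfl
  map_comp f g := rfl
  map_zero X Y := by ext f x; exact f.map_zero
  exact f g h := c.exact_dualMap f g h
  simple X hX := by
    have := IsSimpleModule.nontrivial A X
    obtain ⟨l, hl⟩ := c.exists_isApex X
    have := c.isSimpleModule_twistedDual X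
    exact hl.twistedDual.nonempty_linearEquiv hl
  homLength_le X Y := c.homLength_twistedDual_le

end CellDatum

end LoewyReciprocity

theorem theorem6 {k : Type v} [Field k] [IsAlgClosed k] {A : Type u} [Ring A] [Algebra k A]
    {π : Type w} [PartialOrder π] (L P : π → Type u)
    [∀ a, AddCommGroup (L a)] [∀ a, Module A (L a)]
    [∀ a, AddCommGroup (P a)] [∀ a, Module A (P a)]
    (hL : LoewyReciprocity.IsFullSetOfSimples A L)
    (p : ∀ a, P a →ₗ[A] L a) (hp : ∀ a, LoewyReciprocity.IsProjectiveCover A (p a))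
    (hA : LoewyReciprocity.IsCellular.{u, v, w'} k A ∨ LoewyReciprocity.IsBGG k A L P)
    (l m : π) (s : ℕ) (hs : 1 ≤ s) :
    LoewyReciprocity.compMult A (LoewyReciprocity.radLayer A (P m) s) (L l) =
      LoewyReciprocity.compMult A (LoewyReciprocity.radLayer A (P l) s) (L m) := by
  have := hL.simple
  rcases hA with ⟨⟨c⟩⟩ | h
  · have := c.finiteDimensional
    exact c.selfDuality.compMult_radLayer_eq (hp l) (hp m) hs
  · have := h.quasiHereditary.finiteDimensional
    obtain ⟨D⟩ := h.exists_selfDuality hL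
    exact D.compMult_radLayer_eq (hp l) (hp m) hs
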